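/- Let $\mathfrak h$ be a separable complex Hilbert space, $B(\mathfrak h)=L^1(\mathfrak h)^*$ via the pairing $(x,\rho)\mapsto\operatorname{tr}(x\rho)$, where $L^1(\mathfrak h)$ is the space of trace class operators. A quantum channel is a completely positive, unital, $w^*$-continuous linear map $\Phi:B(\mathfrak h)\to B(\mathfrak h)$; its predual map $\Phi_*$ on $L^1(\mathfrak h)$ is given by $\operatorname{tr}(x\,\Phi_*(\rho))=\operatorname{tr}(\Phi(x)\rho)$. Let $\mathcal P=(\mathcal P_t)_{t\in\mathfrak T}$ be a semigroup of quantum channels ($\mathcal P_0=\mathrm{Id}$, $\mathcal P_{s+t}=\mathcal P_s\mathcal P_t$), where either $\mathfrak T=\mathbb N$ (with counting measure $m$), or $\mathfrak T=[0,\infty)$ (with Lebesgue measure $m$) and $t\mapsto\mathcal P_t(x)$ is $w^*$-continuous for every $x\in B(\mathfrak h)$. A closed subspace $\mathcal V\subseteq\mathfrak h$ is an enclosure for $\mathcal P$ if for every $t\in\mathfrak T$ and every state $\rho$ (positive trace class operator of trace one), $\operatorname{supp}(\rho)\subseteq\mathcal V$ implies $\operatorname{supp}(\mathcal P_{*t}(\rho))\subseteq\mathcal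 V$, where $\operatorname{supp}(x)=\ker(x)^\perp$; $p_{\mathcal V}$ denotes the orthogonal projection onto $\mathcal V$. For $0\le x\in B(\mathfrak h)$ and $v\in\mathfrak h$ put $\mathfrak U(x)[v]=\int_{\mathfrak T}\operatorname{tr}(\mathcal P_{*t}(|v\rangle\langle v|)\,x)\,dm(t)\in[0,\infty]$; $\mathfrak U(x)$ is bounded if $\mathfrak U(x)[v]\le C\|v\|^2$ for all $v$ and some $C<\infty$, and $\operatorname{supp}\mathfrak U(x)=\{v:\mathfrak U(x)[v]=0\}^\perp$. The transient space $\mathcal T$ is the closed linear span of the subspaces $\operatorname{supp}\mathfrak U(x)$ over all $x\ge0$ with $\mathfrak U(x)$ bounded, and $\mathcal P$ is recurrent if the recurrent space $\mathcal R=\mathcal T^\perp$ equals $\mathfrak h$. Let $\mathcal F(\mathcal P)=\{x\in B(\mathfrak h):\mathcal P_t(x)=x\ \ \forall t\in\mathfrak T\}$. **Corollary.** If $\mathcal P$ is recurrent, then $p_{\mathcal V}\in\mathcal F(\mathcal P)$ for every enclosure $\mathcal V$ of $\mathcal P$, and $$\mathcal F(\mathcal P)=\overline{\operatorname{span}_{\mathbb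 C}\{p_{\mathcal V}:\mathcal V\text{ an enclosure of }\mathcal P\}}^{\,\|\cdot\|_\infty},$$ where the closure is taken in the operator norm. -/

import Mathlib

open scoped InnerProductSpace ENNReal NNReal Topology
open MeasureTheory

namespace QChannel

variable {H : Type*} [NormedAddCommGroup H] [InnerProductSpace ℂ H] [CompleteSpace H]

/-! ### Trace class operators and the trace -/

variable (H) in
/-- The index set of a fixed orthonormal basis of `H`. -/
noncomputable def basisIndex : Set H := (exists_hilbertBasis ℂ H).choose

variable (H) in
/-- A fixed orthonormal basis of `H`, used to compute traces. -/
noncomputable def basis : HilbertBasis (basisIndex H) ℂ H :=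
  (exists_hilbertBasis ℂ H).choose_spec.choose

/-- The trace `∑ ⟨e_i, T e_i⟩ ∈ [0, ∞]` of a positive operator. -/
noncomputable def posTrace (T : H →L[ℂ] H) : ℝ≥0∞ :=
  ∑' i, ENNReal.ofReal (RCLike.re ⟪basis H i, T (basis H i)⟫_ℂ)

variable (H) in
/-- The space `L¹(H)` of trace class operators: the complex linear span of the positive bounded
operators with finite trace. -/
noncomputable def traceClass : Submodule ℂ (H →L[ℂ] H) :=
  Submodule.span ℂ {T | 0 ≤ T ∧ posTrace T < ∞}

/-- The trace `tr T = ∑ ⟨e_i, T e_i⟩` (an absolutely convergent sum when `T` is trace class). -/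
noncomputable def trace (T : H →L[ℂ] H) : ℂ :=
  ∑' i, ⟪basis H i, T (basis H i)⟫_ℂ

/-- Parseval's identity in `[0, ∞]`. -/
lemma enorm_sq_eq_tsum (v : H) :
    ENNReal.ofReal (‖v‖ ^ 2) = ∑' i, ENNReal.ofReal (‖⟪basis H i, v⟫_ℂ‖ ^ 2) := by
  have h := (basis H).hasSum_inner_mul_inner v v
  have h2 : HasSum (fun i => ‖⟪basis H i, v⟫_ℂ‖ ^ 2) (‖v‖ ^ 2) := by
    have h3 := Complex.reCLM.hasSum h
    convert h3 using 1
    · funext i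
      simp only [Complex.reCLM_apply]
      rw [← inner_conj_symm v (basis H i), Complex.conj_mul']
      norm_cast
    · rw [inner_self_eq_norm_sq_to_K]
      simp only [Complex.reCLM_apply]
      norm_cast
  rw [← h2.tsum_eq, ENNReal.ofReal_tsum_of_nonneg (fun i => by positivity) h2.summable]

/-- An operator and its adjoint have the same Hilbert-Schmidt norm. -/
lemma tsum_norm_sq_adjoint (A : H →L[ℂ] H) :
    ∑' i, ENNReal.ofReal (‖(ContinuousLinearMap.adjoint A) (basis H i)‖ ^ 2)
      = ∑' i, ENNReal.ofReal (‖A (basis H i)‖ ^ 2) := by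
  rw [tsum_congr fun i => enorm_sq_eq_tsum (A (basis H i)),
    tsum_congr fun i => enorm_sq_eq_tsum (ContinuousLinearMap.adjoint A (basis H i)),
    ENNReal.tsum_comm]
  refine tsum_congr fun i => tsum_congr fun j => ?_
  rw [ContinuousLinearMap.adjoint_inner_right, ← inner_conj_symm, RCLike.norm_conj]

lemma summable_trace_of_pos {T : H →L[ℂ] H} (hT : 0 ≤ T) (hf : posTrace T < ∞)
    (x : H →L[ℂ] H) : Summable fun i => ⟪basis H i, (x * T) (basis H i)⟫_ℂ := by
  set S := CFC.sqrt T with hS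
  have hS0 : 0 ≤ S := CFC.sqrt_nonneg T
  have hSS : S * S = T := CFC.sqrt_mul_sqrt_self T hT
  have hSa : ContinuousLinearMap.adjoint S = S :=
    ((ContinuousLinearMap.nonneg_iff_isPositive S).1 hS0).isSelfAdjoint.adjoint_eq
  have h1 : ∑' i, ENNReal.ofReal (‖S (basis H i)‖ ^ 2) < ∞ := by
    refine lt_of_eq_of_lt (tsum_congr fun i => ?_) hf
    have hm : T (basis H i) = S (S (basis H i)) := by rw [← hSS]; rfl
    rw [hm, ← ContinuousLinearMap.adjoint_inner_left, hSa, inner_self_eq_norm_sq]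
  have h2 : ∑' i, ENNReal.ofReal (‖(ContinuousLinearMap.adjoint (x * S)) (basis H i)‖ ^ 2) < ∞ := by
    rw [tsum_norm_sq_adjoint]
    calc ∑' i, ENNReal.ofReal (‖(x * S) (basis H i)‖ ^ 2)
        ≤ ∑' i, ENNReal.ofReal (‖x‖ ^ 2) * ENNReal.ofReal (‖S (basis H i)‖ ^ 2) := by
          refine ENNReal.tsum_le_tsum fun i => ?_
          rw [← ENNReal.ofReal_mul (by positivity), ← mul_pow]
          exact ENNReal.ofReal_le_ofReal (by
            gcongr
            exact x.le_opNorm _)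
      _ = ENNReal.ofReal (‖x‖ ^ 2) * ∑' i, ENNReal.ofReal (‖S (basis H i)‖ ^ 2) :=
          ENNReal.tsum_mul_left
      _ < ∞ := ENNReal.mul_lt_top ENNReal.ofReal_lt_top h1
  have s1 : Summable fun i => ‖S (basis H i)‖ ^ 2 := by
    have := ENNReal.summable_toReal h1.ne
    simpa [ENNReal.toReal_ofReal] using this
  have s2 : Summable fun i => ‖(ContinuousLinearMap.adjoint (x * S)) (basis H i)‖ ^ 2 := by
    have := ENNReal.summable_toReal h2.ne
    simpa [ENNReal.toReal_ofReal] using this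
  refine Summable.of_norm_bounded (s2.add s1) fun i => ?_
  have : (x * T) (basis H i) = (x * S) (S (basis H i)) := by
    rw [← hSS]; rfl
  rw [this, ← ContinuousLinearMap.adjoint_inner_left]
  refine (norm_inner_le_norm _ _).trans ?_
  nlinarith [sq_nonneg (‖(ContinuousLinearMap.adjoint (x * S)) (basis H i)‖ - ‖S (basis H i)‖),
    sq_nonneg (‖(ContinuousLinearMap.adjoint (x * S)) (basis H i)‖),
    sq_nonneg (‖S (basis H i)‖)]

lemma summable_trace {T : H →L[ℂ] H} (hT : T ∈ traceClass H) (x : H →L[ℂ] H) :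
    Summable fun i => ⟪basis H i, (x * T) (basis H i)⟫_ℂ := by
  induction hT using Submodule.span_induction with
  | mem T h => exact summable_trace_of_pos h.1 h.2 x
  | zero => simp
  | add S T _ _ hS hT =>
    refine (hS.add hT).congr fun i => ?_
    simp [mul_add]
  | smul c T _ hT =>
    refine (hT.mul_left c).congr fun i => ?_
    simp

variable (H) in
/-- The duality pairing `(x, ρ) ↦ tr (x ρ)` between `B(H)` and `L¹(H)`. -/
noncomputable def tracePairing : (H →L[ℂ] H) →ₗ[ℂ] traceClass H →ₗ[ℂ] ℂ :=
  LinearMap.mk₂ ℂ (fun x ρ => trace (x * (ρ : H →L[ℂ] H)))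
    (fun x y ρ => by
      simp only [trace]
      rw [← (summable_trace ρ.2 x).tsum_add (summable_trace ρ.2 y)]
      simp [add_mul])
    (fun c x ρ => by
      simp only [trace, smul_eq_mul, ← tsum_mul_left]
      simp)
    (fun x ρ σ => by
      simp only [trace]
      rw [← (summable_trace ρ.2 x).tsum_add (summable_trace σ.2 x)]
      simp [mul_add])
    (fun c x ρ => by
      simp only [trace, smul_eq_mul, ← tsum_mul_left]
      simp)

variable (H) in
/-- The `w*`-topology of `B(H) = L¹(H)*`: the coarsest topology that makes every functional
`x ↦ tr (x ρ)`, `ρ` trace class, continuous. -/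
@[reducible]
noncomputable def weakStarTopology : TopologicalSpace (H →L[ℂ] H) :=
  ⨅ ρ : traceClass H, TopologicalSpace.induced (fun x => trace (x * (ρ : H →L[ℂ] H))) inferInstance

/-- The operator `|v⟩⟨v|`, which sends `u` to `⟨v, u⟩ v`, as a trace class operator. -/
noncomputable def ketbra (v : H) : traceClass H :=
  ⟨InnerProductSpace.rankOne ℂ v v, Submodule.subset_span
    ⟨(ContinuousLinearMap.nonneg_iff_isPositive _).2 (InnerProductSpace.isPositive_rankOne_self v),
      by
        have h : posTrace (InnerProductSpace.rankOne ℂ v v) = ENNReal.ofReal (‖v‖ ^ 2) := by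
          rw [enorm_sq_eq_tsum, posTrace]
          refine tsum_congr fun i => ?_
          rw [InnerProductSpace.rankOne_apply, inner_smul_right,
            ← inner_conj_symm v (basis H i), RCLike.conj_mul]
          norm_cast
        rw [h]
        exact ENNReal.ofReal_lt_top⟩⟩

lemma trace_rankOne_mul (T : H →L[ℂ] H) (v w : H) :
    trace (InnerProductSpace.rankOne ℂ v w * T) = ⟪w, T v⟫_ℂ := by
  rw [← ContinuousLinearMap.adjoint_inner_left, ← (basis H).tsum_inner_mul_inner, trace]
  refine tsum_congr fun i => ?_
  rw [ContinuousLinearMap.adjoint_inner_left]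
  exact inner_smul_right _ _ _

/-- A state: a positive trace class operator of unit trace. -/
def IsState (ρ : traceClass H) : Prop :=
  0 ≤ (ρ : H →L[ℂ] H) ∧ trace (ρ : H →L[ℂ] H) = 1

/-- The support `(ker x)ᗮ` of an operator. -/
noncomputable def supp (x : H →L[ℂ] H) : ClosedSubmodule ℂ H :=
  ⟨(LinearMap.ker (x : H →ₗ[ℂ] H))ᗮ, Submodule.isClosed_orthogonal _⟩

/-- The orthogonal projection onto a closed subspace. -/
noncomputable def proj (V : ClosedSubmodule ℂ H) : H →L[ℂ] H :=
  V.toSubmodule.starProjection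

/-! ### Quantum channels and their predual maps -/

end QChannel

open QChannel

/-- A quantum channel on `B(H)`: a completely positive, unital, `w*`-continuous linear map. -/
structure QuantumChannel (H : Type*) [NormedAddCommGroup H] [InnerProductSpace ℂ H]
    [CompleteSpace H] extends CompletelyPositiveMap (H →L[ℂ] H) (H →L[ℂ] H) where
  map_one' : toFun 1 = 1
  weakStar_continuous' :
    Continuous[weakStarTopology H, weakStarTopology H] toFun

namespace QuantumChannel

variable {H : Type*} [NormedAddCommGroup H] [InnerProductSpace ℂ H] [CompleteSpace H]

instance : CoeFun (QuantumChannel H) fun _ => (H →L[ℂ] H) → (H →L[ℂ] H) :=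
  ⟨fun Φ => Φ.toFun⟩

lemma exists_predual (Φ : QuantumChannel H) (ρ : traceClass H) :
    ∃ σ : traceClass H, ∀ x : H →L[ℂ] H,
      trace (x * (σ : H →L[ℂ] H)) = trace (Φ x * (ρ : H →L[ℂ] H)) := by
  set φ : (H →L[ℂ] H) →ₗ[ℂ] ℂ := (tracePairing H).flip ρ ∘ₗ Φ.toLinearMap with hφ
  have hc : Continuous[⨅ σ : traceClass H,
      TopologicalSpace.induced ((tracePairing H).flip σ) inferInstance, inferInstance] φ := by
    have h1 : Continuous[weakStarTopology H, inferInstance]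
        (fun x : H →L[ℂ] H => trace (x * (ρ : H →L[ℂ] H))) :=
      continuous_iInf_dom (i := ρ) continuous_induced_dom
    exact @Continuous.comp _ _ _ (weakStarTopology H) (weakStarTopology H) _ Φ.toFun
      (fun x : H →L[ℂ] H => trace (x * (ρ : H →L[ℂ] H))) h1 Φ.weakStar_continuous'
  have hm := (LinearMap.mem_span_iff_continuous φ).2 hc
  have hr : Submodule.span ℂ (Set.range fun σ => (tracePairing H).flip σ)
      = LinearMap.range (tracePairing H).flip := by
    rw [← LinearMap.coe_range, Submodule.span_eq]
  rw [hr] at hm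
  obtain ⟨σ, hσ⟩ := hm
  exact ⟨σ, fun x => congrArg (fun f : (H →L[ℂ] H) →ₗ[ℂ] ℂ => f x) hσ⟩

/-- The predual map `Φ_*` on `L¹(H)`, determined by `tr (x Φ_*(ρ)) = tr (Φ(x) ρ)` for all `x`. -/
noncomputable def predual (Φ : QuantumChannel H) (ρ : traceClass H) : traceClass H :=
  (Φ.exists_predual ρ).choose

lemma trace_mul_predual (Φ : QuantumChannel H) (ρ : traceClass H) (x : H →L[ℂ] H) :
    trace (x * (Φ.predual ρ : H →L[ℂ] H)) = trace (Φ x * (ρ : H →L[ℂ] H)) :=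
  (Φ.exists_predual ρ).choose_spec x

lemma eq_predual (Φ : QuantumChannel H) (ρ σ : traceClass H)
    (h : ∀ x : H →L[ℂ] H, trace (x * (σ : H →L[ℂ] H)) = trace (Φ x * (ρ : H →L[ℂ] H))) :
    σ = Φ.predual ρ := by
  refine Subtype.ext (ContinuousLinearMap.ext fun v => ext_inner_left ℂ fun w => ?_)
  rw [← trace_rankOne_mul, ← trace_rankOne_mul, h, trace_mul_predual]

/-- The closed subspace `V` is an enclosure for `Φ`: for every state `ρ`, if `supp ρ ⊆ V` then
`supp Φ_*(ρ) ⊆ V`. -/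
def IsEnclosure (Φ : QuantumChannel H) (V : ClosedSubmodule ℂ H) : Prop :=
  ∀ ρ : traceClass H, IsState ρ → supp (ρ : H →L[ℂ] H) ≤ V →
    supp (Φ.predual ρ : H →L[ℂ] H) ≤ V

end QuantumChannel

/-! ### Semigroups of quantum channels -/

/-- A semigroup of quantum channels indexed by `T`, pointwise `w*`-continuous in time. For `T = ℕ`
the continuity is void and the semigroup consists of the powers of a single channel. -/
structure QuantumSemigroup (T : Type*) [AddMonoid T] [TopologicalSpace T]
    (H : Type*) [NormedAddCommGroup H] [InnerProductSpace ℂ H] [CompleteSpace H] where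
  channel : T → QuantumChannel H
  channel_zero : ∀ x, channel 0 x = x
  channel_add : ∀ s t x, channel (s + t) x = channel s (channel t x)
  weakStar_continuous : ∀ x : H →L[ℂ] H,
    Continuous[inferInstance, weakStarTopology H] fun t => channel t x

namespace QuantumSemigroup

variable {T : Type*} [AddMonoid T] [TopologicalSpace T]
variable {H : Type*} [NormedAddCommGroup H] [InnerProductSpace ℂ H] [CompleteSpace H]

/-- An enclosure for the semigroup is an enclosure for each of its channels. -/
def IsEnclosure (P : QuantumSemigroup T H) (V : ClosedSubmodule ℂ H) : Prop :=
  ∀ t, (P.channel t).IsEnclosure V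

/-- The set of fixed points (harmonic operators). -/
def fixedPoints (P : QuantumSemigroup T H) : Set (H →L[ℂ] H) :=
  {x | ∀ t, P.channel t x = x}

variable [MeasurableSpace T]

/-- The form-potential `𝔘(x)[v] = ∫ tr (P_{*t}(|v⟩⟨v|) x) dm(t) ∈ [0, ∞]` of a positive `x`. The
order of the factors in the trace is immaterial. -/
noncomputable def formPotential (P : QuantumSemigroup T H) (m : Measure T) (x : H →L[ℂ] H)
    (v : H) : ℝ≥0∞ :=
  ∫⁻ t, ENNReal.ofReal
    (trace (x * ((P.channel t).predual (ketbra v) : H →L[ℂ] H))).re ∂m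

/-- The form-potential of `x` is bounded. -/
def IsBoundedPotential (P : QuantumSemigroup T H) (m : Measure T) (x : H →L[ℂ] H) : Prop :=
  ∃ C : ℝ≥0, ∀ v : H, P.formPotential m x v ≤ C * ENNReal.ofReal (‖v‖ ^ 2)

/-- The support of the form-potential of `x`: the orthogonal complement of its kernel
`{v | 𝔘(x)[v] = 0}`. -/
noncomputable def suppPotential (P : QuantumSemigroup T H) (m : Measure T) (x : H →L[ℂ] H) :
    ClosedSubmodule ℂ H :=
  ⟨(Submodule.span ℂ {v | P.formPotential m x v = 0})ᗮ, Submodule.isClosed_orthogonal _⟩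

/-- The transient space: the closed span of the supports of the bounded form-potentials of
positive operators. -/
noncomputable def transientSpace (P : QuantumSemigroup T H) (m : Measure T) :
    ClosedSubmodule ℂ H :=
  sSup {W | ∃ x : H →L[ℂ] H, 0 ≤ x ∧ P.IsBoundedPotential m x ∧ W = P.suppPotential m x}

/-- The recurrent space: the orthogonal complement of the transient space. -/
noncomputable def recurrentSpace (P : QuantumSemigroup T H) (m : Measure T) :
    ClosedSubmodule ℂ H :=
  (P.transientSpace m).orthogonal

/-- The semigroup is recurrent if its recurrent space is all of `H`. -/
def IsRecurrent (P : QuantumSemigroup T H) (m : Measure T) : Prop :=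
  P.recurrentSpace m = ⊤

end QuantumSemigroup

/-- Lebesgue measure on the half-line `[0, ∞)`. -/
noncomputable def lebesgueHalfLine : Measure ℝ≥0 :=
  Measure.comap ((↑) : ℝ≥0 → ℝ) volume

/-! Recurrence enters only through `SubharmonicFixed`: a selfadjoint `z` with `z ≤ P_t z` for all
`t` is fixed. The operator `x = P_s z - z ≥ 0` is a coboundary, so its potential telescopes and is
bounded by a multiple of `‖z‖ ‖v‖²` (`subharmonicFixed_nat`, `subharmonicFixed_nnreal`). Recurrence
makes the support of that potential zero, and since the time-zero contribution sees `x` itself, `x =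
0` (`IsRecurrent.eq_zero`).

The rest is algebra. Projections onto enclosures are subharmonic (`IsEnclosure.proj_le`), hence
fixed. By Kadison-Schwarz `star x * x` is subharmonic for fixed `x`, so the fixed points form a
C*-algebra, stable under positive parts. Conversely, kernels of positive fixed operators are
enclosures (`isEnclosure_ker`).

Density is a binary expansion rather than the spectral theorem. For fixed `0 ≤ x ≤ 1`, the
projection `p` onto the orthogonal complement of `ker (2x - 1)⁺` lies in the span, and `2x - p` is
again fixed and between `0` and `1` (`exists_digit`). Iterating approximates `x` in norm with error
`2⁻ⁿ`; scaling and the decompositions into positive and selfadjoint parts do the rest. -/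

lemma CStarAlgebra.exists_eq_star_mul_self_of_nonneg {A : Type*} [NonUnitalCStarAlgebra A]
    [PartialOrder A] [StarOrderedRing A] {a : A} (h : 0 ≤ a) : ∃ b, a = star b * b :=
  CStarAlgebra.nonneg_iff_eq_star_mul_self.1 h

/-! ### Positivity of channels and the Kadison-Schwarz inequality -/

namespace QuantumChannel

variable {H : Type*} [NormedAddCommGroup H] [InnerProductSpace ℂ H] [CompleteSpace H]

lemma map_add (Φ : QuantumChannel H) (x y : H →L[ℂ] H) : Φ (x + y) = Φ x + Φ y :=
  Φ.toLinearMap.map_add x y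

lemma map_sub (Φ : QuantumChannel H) (x y : H →L[ℂ] H) : Φ (x - y) = Φ x - Φ y :=
  Φ.toLinearMap.map_sub x y

lemma map_smul (Φ : QuantumChannel H) (c : ℂ) (x : H →L[ℂ] H) : Φ (c • x) = c • Φ x :=
  Φ.toLinearMap.map_smul c x

lemma map_one (Φ : QuantumChannel H) : Φ 1 = 1 := Φ.map_one'

lemma map_nonneg (Φ : QuantumChannel H) {x : H →L[ℂ] H} (hx : 0 ≤ x) : 0 ≤ Φ x :=
  _root_.map_nonneg Φ.toCompletelyPositiveMap hx

lemma mono (Φ : QuantumChannel H) {x y : H →L[ℂ] H} (h : x ≤ y) : Φ x ≤ Φ y :=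
  OrderHomClass.mono Φ.toCompletelyPositiveMap h

lemma map_star (Φ : QuantumChannel H) (x : H →L[ℂ] H) : Φ (star x) = star (Φ x) :=
  StarHomClass.map_star Φ.toCompletelyPositiveMap x

lemma continuous (Φ : QuantumChannel H) : Continuous Φ.toFun :=
  map_continuous Φ.toCompletelyPositiveMap

/-- The Kadison-Schwarz inequality. -/
lemma star_mul_self_le (Φ : QuantumChannel H) (x : H →L[ℂ] H) :
    star (Φ x) * Φ x ≤ Φ (star x * x) := by
  -- `star N * N` is the matrix with rows `(x*x, x*)` and `(x, 1)`; only positivity on 2 × 2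
  -- matrices is needed.
  set N : CStarMatrix (Fin 2) (Fin 2) (H →L[ℂ] H) := CStarMatrix.ofMatrix !![x, 1; 0, 0] with hN
  have h1 : 0 ≤ (star N * N).map Φ.toLinearMap :=
    Φ.map_cstarMatrix_nonneg' 2 _ (star_mul_self_nonneg N)
  obtain ⟨K, hK⟩ := CStarAlgebra.exists_eq_star_mul_self_of_nonneg h1
  have e (i j : Fin 2) : Φ (star (N 0 i) * N 0 j + star (N 1 i) * N 1 j)
      = star (K 0 i) * K 0 j + star (K 1 i) * K 1 j := by
    have := congrFun (congrFun hK i) j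
    simpa [CStarMatrix.mul_apply, Fin.sum_univ_two, CStarMatrix.star_apply] using this
  have e00 := e 0 0
  have e10 := e 1 0
  have e11 := e 1 1
  simp only [hN, CStarMatrix.ofMatrix_apply, Matrix.of_apply, Matrix.cons_val', Matrix.cons_val_zero,
    Matrix.cons_val_one, star_one, star_zero, mul_zero, add_zero, one_mul,
    mul_one, map_one] at e00 e10 e11
  have e01 := congrArg star e10
  simp only [star_add, star_mul, star_star] at e01
  -- Schur complement: the image matrix `star K * K` is evaluated on the column `(1, -Φ x)`, the
  -- lower right entry being `Φ 1 = 1`.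
  have h2 : Φ (star x * x) - star (Φ x) * Φ x
      = star (K 0 0 - K 0 1 * Φ x) * (K 0 0 - K 0 1 * Φ x)
        + star (K 1 0 - K 1 1 * Φ x) * (K 1 0 - K 1 1 * Φ x) := by
    have h3 : star (K 0 0 - K 0 1 * Φ x) * (K 0 0 - K 0 1 * Φ x)
        + star (K 1 0 - K 1 1 * Φ x) * (K 1 0 - K 1 1 * Φ x)
        = (star (K 0 0) * K 0 0 + star (K 1 0) * K 1 0)
          - (star (K 0 0) * K 0 1 + star (K 1 0) * K 1 1) * Φ x
          - star (Φ x) * (star (K 0 1) * K 0 0 + star (K 1 1) * K 1 0)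
          + star (Φ x) * (star (K 0 1) * K 0 1 + star (K 1 1) * K 1 1) * Φ x := by
      simp only [star_sub, star_mul]
      noncomm_ring
    rw [h3, ← e00, ← e01, ← e10, ← e11]
    noncomm_ring
  rw [← sub_nonneg, h2]
  exact add_nonneg (star_mul_self_nonneg _) (star_mul_self_nonneg _)

end QuantumChannel

/-! ### The C*-algebra of fixed points -/

namespace QuantumSemigroup

variable {T : Type*} [AddMonoid T] [TopologicalSpace T]
variable {H : Type*} [NormedAddCommGroup H] [InnerProductSpace ℂ H] [CompleteSpace H]

/-- Every selfadjoint subharmonic operator is harmonic. -/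
def SubharmonicFixed (P : QuantumSemigroup T H) : Prop :=
  ∀ z : H →L[ℂ] H, IsSelfAdjoint z → (∀ t, z ≤ P.channel t z) → z ∈ P.fixedPoints

lemma isClosed_fixedPoints (P : QuantumSemigroup T H) : IsClosed P.fixedPoints := by
  have : P.fixedPoints = ⋂ t, {x | P.channel t x = x} := by
    ext x; simp [fixedPoints]
  rw [this]
  exact isClosed_iInter fun t => isClosed_eq (P.channel t).continuous continuous_id

/-- The fixed points as a linear subspace. -/
def fixedSubmodule (P : QuantumSemigroup T H) : Submodule ℂ (H →L[ℂ] H) where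
  carrier := P.fixedPoints
  add_mem' ha hb t := by rw [QuantumChannel.map_add, ha t, hb t]
  zero_mem' t := (P.channel t).toLinearMap.map_zero
  smul_mem' c x hx t := by rw [QuantumChannel.map_smul, hx t]

lemma star_mem_fixedPoints (P : QuantumSemigroup T H) {x : H →L[ℂ] H} (hx : x ∈ P.fixedPoints) :
    star x ∈ P.fixedPoints := fun t => by rw [QuantumChannel.map_star, hx t]

/-- Kadison-Schwarz makes `star x * x` subharmonic when `x` is fixed. -/
lemma SubharmonicFixed.star_mul_self_mem {P : QuantumSemigroup T H} (hP : P.SubharmonicFixed)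
    {x : H →L[ℂ] H} (hx : x ∈ P.fixedPoints) : star x * x ∈ P.fixedPoints :=
  hP _ (.star_mul_self x) fun t => by
    have := (P.channel t).star_mul_self_le x
    rwa [hx t] at this

lemma SubharmonicFixed.mul_mem {P : QuantumSemigroup T H} (hP : P.SubharmonicFixed)
    {x y : H →L[ℂ] H} (hx : x ∈ P.fixedPoints) (hy : y ∈ P.fixedPoints) :
    x * y ∈ P.fixedPoints := by
  -- Polarization of `star x * x`, with `star x` and `y` as the two arguments, so that the cross
  -- term is `x * y`.
  have key (c : ℂ) : star (y + c • star x) * (y + c • star x) ∈ P.fixedSubmodule :=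
    hP.star_mul_self_mem (P.fixedSubmodule.add_mem hy
      (P.fixedSubmodule.smul_mem c (P.star_mem_fixedPoints hx)))
  have h : x * y = (4⁻¹ : ℂ) • (star (y + (1 : ℂ) • star x) * (y + (1 : ℂ) • star x)
      - star (y + (-1 : ℂ) • star x) * (y + (-1 : ℂ) • star x)
      + Complex.I • (star (y + Complex.I • star x) * (y + Complex.I • star x))
      - Complex.I • (star (y + (-Complex.I) • star x) * (y + (-Complex.I) • star x))) := by
    simp only [star_add, star_smul, star_star, add_mul, mul_add, smul_mul_assoc, mul_smul_comm,
      smul_smul, smul_add, smul_sub]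
    simp only [Complex.star_def, map_one, map_neg, Complex.conj_I, neg_neg]
    match_scalars <;> ring_nf
    all_goals simp
    all_goals norm_num
  rw [h]
  exact P.fixedSubmodule.smul_mem _ (P.fixedSubmodule.sub_mem (P.fixedSubmodule.add_mem
    (P.fixedSubmodule.sub_mem (key _) (key _)) (P.fixedSubmodule.smul_mem _ (key _)))
    (P.fixedSubmodule.smul_mem _ (key _)))

/-- If subharmonic operators are harmonic, the fixed points form a C*-algebra. -/
def SubharmonicFixed.starSubalgebra {P : QuantumSemigroup T H} (hP : P.SubharmonicFixed) :
    StarSubalgebra ℂ (H →L[ℂ] H) where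
  carrier := P.fixedPoints
  add_mem' ha hb := P.fixedSubmodule.add_mem ha hb
  mul_mem' ha hb := hP.mul_mem ha hb
  algebraMap_mem' c := by
    rw [Algebra.algebraMap_eq_smul_one]
    exact P.fixedSubmodule.smul_mem c fun t => (P.channel t).map_one
  star_mem' hx := P.star_mem_fixedPoints hx

/-- A norm closed star subalgebra is stable under continuous functional calculus. Selfadjointness is
not required because the calculus returns zero otherwise. -/
lemma SubharmonicFixed.posPart_mem {P : QuantumSemigroup T H} (hP : P.SubharmonicFixed)
    {x : H →L[ℂ] H} (hx : x ∈ P.fixedPoints) : x⁺ ∈ P.fixedPoints := by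
  have : IsClosed (hP.starSubalgebra : Set (H →L[ℂ] H)) := P.isClosed_fixedPoints
  rw [CFC.posPart_def, cfcₙ_eq_cfc]
  exact cfc_mem (𝕜' := ℂ) (s := hP.starSubalgebra) _ hx

end QuantumSemigroup

/-! ### Traces against positive operators, supports and projections -/

namespace QChannel

variable {H : Type*} [NormedAddCommGroup H] [InnerProductSpace ℂ H] [CompleteSpace H]

lemma trace_mul_ketbra (x : H →L[ℂ] H) (v : H) :
    trace (x * (ketbra v : H →L[ℂ] H)) = ⟪v, x v⟫_ℂ := by
  have : x * (ketbra v : H →L[ℂ] H) = InnerProductSpace.rankOne ℂ (x v) v * 1 := by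
    ext u; simp [ketbra]
  rw [this, trace_rankOne_mul]
  rfl

omit [CompleteSpace H] in
lemma re_inner_nonneg {x : H →L[ℂ] H} (hx : 0 ≤ x) (v : H) : 0 ≤ (⟪v, x v⟫_ℂ).re :=
  ((ContinuousLinearMap.nonneg_iff_isPositive x).1 hx).re_inner_nonneg_right v

lemma inner_sqrt {x : H →L[ℂ] H} (hx : 0 ≤ x) (v w : H) :
    ⟪v, x w⟫_ℂ = ⟪CFC.sqrt x v, CFC.sqrt x w⟫_ℂ := by
  have hS : ContinuousLinearMap.adjoint (CFC.sqrt x) = CFC.sqrt x :=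
    ((ContinuousLinearMap.nonneg_iff_isPositive _).1 (CFC.sqrt_nonneg x)).isSelfAdjoint.adjoint_eq
  have h2 : x w = CFC.sqrt x (CFC.sqrt x w) := by
    conv_lhs => rw [← CFC.sqrt_mul_sqrt_self x hx]
    rfl
  rw [h2, ← ContinuousLinearMap.adjoint_inner_left, hS]

/-- A positive operator annihilates the vectors on which its quadratic form vanishes. -/
lemma apply_eq_zero_of_re_inner {x : H →L[ℂ] H} (hx : 0 ≤ x) {v : H} (h : (⟪v, x v⟫_ℂ).re = 0) :
    x v = 0 := by
  rw [inner_sqrt hx, inner_self_eq_norm_sq_to_K] at h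
  have h1 : CFC.sqrt x v = 0 := by
    have : ‖CFC.sqrt x v‖ ^ 2 = 0 := by exact_mod_cast h
    simpa using this
  refine ext_inner_left ℂ fun w => ?_
  rw [inner_sqrt hx, h1]
  simp

/-- Trace class is defined as a span, so finiteness is recovered from the summability of the
diagonal. -/
lemma posTrace_lt_top {T : H →L[ℂ] H} (hT : T ∈ traceClass H) : posTrace T < ∞ := by
  have h := Complex.reCLM.summable (summable_trace hT 1)
  have h1 : Summable fun i => (⟪basis H i, T (basis H i)⟫_ℂ).re := by simpa using h
  exact h1.tsum_ofReal_lt_top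

lemma summable_norm_sq_sqrt {T : H →L[ℂ] H} (h0 : 0 ≤ T) (hf : posTrace T < ∞) :
    Summable fun i => ‖CFC.sqrt T (basis H i)‖ ^ 2 := by
  have h1 : ∑' i, ENNReal.ofReal (‖CFC.sqrt T (basis H i)‖ ^ 2) < ∞ := by
    refine lt_of_eq_of_lt (tsum_congr fun i => ?_) hf
    rw [inner_sqrt h0, inner_self_eq_norm_sq]
  simpa [ENNReal.toReal_ofReal] using ENNReal.summable_toReal h1.ne

lemma summable_norm_sq_matrix {A : H →L[ℂ] H} (hA : Summable fun i => ‖A (basis H i)‖ ^ 2) :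
    Summable fun p : basisIndex H × basisIndex H =>
      ‖⟪basis H p.2, A (basis H p.1)⟫_ℂ‖ ^ 2 := by
  have h (i : basisIndex H) : HasSum (fun j => ‖⟪basis H j, A (basis H i)⟫_ℂ‖ ^ 2)
      (‖A (basis H i)‖ ^ 2) := by
    have h3 := Complex.reCLM.hasSum
      ((basis H).hasSum_inner_mul_inner (A (basis H i)) (A (basis H i)))
    convert h3 using 1
    · funext j
      simp only [Complex.reCLM_apply]
      rw [← inner_conj_symm (A (basis H i)) (basis H j), Complex.conj_mul']
      norm_cast
    · rw [inner_self_eq_norm_sq_to_K]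
      simp only [Complex.reCLM_apply]
      norm_cast
  rw [summable_prod_of_nonneg fun _ => by positivity]
  exact ⟨fun i => (h i).summable, hA.congr fun i => (h i).tsum_eq.symm⟩

/-- The Hilbert-Schmidt pairing is symmetric under taking adjoints. -/
lemma tsum_inner_adjoint {A B : H →L[ℂ] H} (hA : Summable fun i => ‖A (basis H i)‖ ^ 2)
    (hB : Summable fun i => ‖B (basis H i)‖ ^ 2) :
    ∑' i, ⟪ContinuousLinearMap.adjoint A (basis H i), B (basis H i)⟫_ℂ
      = ∑' i, ⟪ContinuousLinearMap.adjoint B (basis H i), A (basis H i)⟫_ℂ := by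
  -- Both matrices are square summable, so the double series converges absolutely and the two sums
  -- may be exchanged.
  have hs : Summable fun p : basisIndex H × basisIndex H =>
      ⟪basis H p.1, A (basis H p.2)⟫_ℂ * ⟪basis H p.2, B (basis H p.1)⟫_ℂ := by
    have h1 : Summable fun p : basisIndex H × basisIndex H =>
        ‖⟪basis H p.1, A (basis H p.2)⟫_ℂ‖ ^ 2 := (summable_norm_sq_matrix hA).prod_symm
    refine Summable.of_norm_bounded (h1.add (summable_norm_sq_matrix hB)) fun p => ?_
    rw [norm_mul]
    nlinarith [sq_nonneg (‖⟪basis H p.1, A (basis H p.2)⟫_ℂ‖ - ‖⟪basis H p.2, B (basis H p.1)⟫_ℂ‖),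
      sq_nonneg ‖⟪basis H p.1, A (basis H p.2)⟫_ℂ‖, sq_nonneg ‖⟪basis H p.2, B (basis H p.1)⟫_ℂ‖]
  have e (C D : H →L[ℂ] H) (i : basisIndex H) :
      ⟪ContinuousLinearMap.adjoint C (basis H i), D (basis H i)⟫_ℂ
      = ∑' j, ⟪basis H i, C (basis H j)⟫_ℂ * ⟪basis H j, D (basis H i)⟫_ℂ := by
    rw [← (basis H).tsum_inner_mul_inner]
    simp only [ContinuousLinearMap.adjoint_inner_left]
  simp only [e]
  rw [← Summable.tsum_comm
    (f := fun i j => ⟪basis H i, A (basis H j)⟫_ℂ * ⟪basis H j, B (basis H i)⟫_ℂ) hs]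
  exact tsum_congr fun j => tsum_congr fun i => mul_comm _ _

/-- `tr (x T) = tr (√T x √T)` for positive trace class `T`. -/
lemma trace_mul_eq_tsum_sqrt {T : H →L[ℂ] H} (h0 : 0 ≤ T) (hf : posTrace T < ∞)
    (x : H →L[ℂ] H) :
    trace (x * T) = ∑' i, ⟪CFC.sqrt T (basis H i), x (CFC.sqrt T (basis H i))⟫_ℂ := by
  have hS : ContinuousLinearMap.adjoint (CFC.sqrt T) = CFC.sqrt T :=
    ((ContinuousLinearMap.nonneg_iff_isPositive _).1 (CFC.sqrt_nonneg T)).isSelfAdjoint.adjoint_eq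
  have s1 := summable_norm_sq_sqrt h0 hf
  have s2 : Summable fun i => ‖(x * CFC.sqrt T) (basis H i)‖ ^ 2 := by
    refine Summable.of_nonneg_of_le (fun _ => by positivity) (fun i => ?_) (s1.mul_left (‖x‖ ^ 2))
    rw [← mul_pow]
    gcongr
    exact x.le_opNorm _
  -- Cyclicity of the trace, for the Hilbert-Schmidt factors `x √T` and `√T`.
  have h := tsum_inner_adjoint s2 s1
  rw [hS] at h
  rw [trace]
  refine Eq.trans (tsum_congr fun i => ?_) h
  rw [ContinuousLinearMap.adjoint_inner_left]
  conv_lhs => rw [← CFC.sqrt_mul_sqrt_self T h0]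
  rfl

lemma summable_inner_sqrt {T : H →L[ℂ] H} (h0 : 0 ≤ T) (hf : posTrace T < ∞) (x : H →L[ℂ] H) :
    Summable fun i => ⟪CFC.sqrt T (basis H i), x (CFC.sqrt T (basis H i))⟫_ℂ := by
  refine Summable.of_norm_bounded ((summable_norm_sq_sqrt h0 hf).mul_left ‖x‖) fun i => ?_
  refine (norm_inner_le_norm _ _).trans ?_
  rw [sq, mul_comm, ← mul_assoc]
  gcongr
  exact x.le_opNorm _

lemma hasSum_re_trace_mul {T : H →L[ℂ] H} (h0 : 0 ≤ T) (hf : posTrace T < ∞) (x : H →L[ℂ] H) :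
    HasSum (fun i => (⟪CFC.sqrt T (basis H i), x (CFC.sqrt T (basis H i))⟫_ℂ).re)
      (trace (x * T)).re := by
  rw [trace_mul_eq_tsum_sqrt h0 hf]
  exact Complex.reCLM.hasSum (summable_inner_sqrt h0 hf x).hasSum

/-- If `x, T ≥ 0` and `tr (x T) = 0`, then `x T = 0`. -/
lemma mul_eq_zero_of_trace {T x : H →L[ℂ] H} (h0 : 0 ≤ T) (hf : posTrace T < ∞) (hx : 0 ≤ x)
    (h : (trace (x * T)).re = 0) : x * T = 0 := by
  have h1 := hasSum_re_trace_mul h0 hf x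
  -- A vanishing sum of nonnegative terms: the form of `x` vanishes at every `√T e_i`, whence `x √T
  -- = 0`.
  rw [h, hasSum_zero_iff_of_nonneg fun _ => re_inner_nonneg hx _] at h1
  have h2 : x * CFC.sqrt T = 0 := by
    refine ContinuousLinearMap.ext_on (s := Set.range (basis H)) ?_ ?_
    · have := (basis H).dense_span
      rw [Submodule.dense_iff_topologicalClosure_eq_top]
      exact this
    · rintro _ ⟨i, rfl⟩
      exact apply_eq_zero_of_re_inner hx (congrFun h1 i)
  rw [← CFC.sqrt_mul_sqrt_self T h0, ← mul_assoc, h2, zero_mul]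

open scoped ComplexOrder in
lemma trace_mul_nonneg {T x : H →L[ℂ] H} (h0 : 0 ≤ T) (hf : posTrace T < ∞) (hx : 0 ≤ x) :
    0 ≤ trace (x * T) := by
  rw [trace_mul_eq_tsum_sqrt h0 hf]
  exact tsum_nonneg fun i =>
    ((ContinuousLinearMap.nonneg_iff_isPositive x).1 hx).inner_nonneg_right _

open scoped ComplexOrder in
omit [CompleteSpace H] in
lemma nonneg_of_inner_nonneg {T : H →L[ℂ] H} (h : ∀ v, 0 ≤ ⟪v, T v⟫_ℂ) : 0 ≤ T := by
  rw [ContinuousLinearMap.nonneg_iff_isPositive, ContinuousLinearMap.isPositive_iff_complex]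
  intro v
  have h1 := Complex.nonneg_iff.1 (h v)
  have h2 : ⟪T v, v⟫_ℂ = ⟪v, T v⟫_ℂ := by
    rw [← inner_conj_symm, Complex.conj_eq_iff_im.2 h1.2.symm]
  rw [h2]
  exact ⟨Complex.ext rfl h1.2, h1.1⟩

omit [CompleteSpace H] in
lemma mem_supp {x : H →L[ℂ] H} {v : H} : v ∈ supp x ↔ ∀ u, x u = 0 → ⟪u, v⟫_ℂ = 0 := by
  change v ∈ (LinearMap.ker (x : H →ₗ[ℂ] H))ᗮ ↔ _
  simp [Submodule.mem_orthogonal]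

lemma apply_mem_supp {x : H →L[ℂ] H} (hx : IsSelfAdjoint x) (u : H) : x u ∈ supp x :=
  mem_supp.2 fun w hw => by
    rw [← ContinuousLinearMap.adjoint_inner_left, hx.adjoint_eq, hw, inner_zero_left]

lemma proj_apply_eq_self {V : ClosedSubmodule ℂ H} {v : H} : proj V v = v ↔ v ∈ V :=
  Submodule.starProjection_eq_self_iff

lemma isStarProjection_proj (V : ClosedSubmodule ℂ H) : IsStarProjection (proj V) :=
  isStarProjection_starProjection

lemma proj_mul_self (V : ClosedSubmodule ℂ H) : proj V * proj V = proj V :=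
  (isStarProjection_proj V).isIdempotentElem

lemma star_proj (V : ClosedSubmodule ℂ H) : star (proj V) = proj V :=
  (isStarProjection_proj V).isSelfAdjoint

end QChannel

/-! ### Enclosures, kernels of fixed points and subharmonic projections -/

namespace QuantumChannel

variable {H : Type*} [NormedAddCommGroup H] [InnerProductSpace ℂ H] [CompleteSpace H]

/-- By duality the quadratic form of `Φ_* ρ` at `v` is the trace of `Φ(|v⟩⟨v|) ρ`, a pairing of two
positive operators. -/
lemma predual_nonneg (Φ : QuantumChannel H) {ρ : traceClass H} (hρ : 0 ≤ (ρ : H →L[ℂ] H)) :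
    0 ≤ (Φ.predual ρ : H →L[ℂ] H) := by
  refine nonneg_of_inner_nonneg fun v => ?_
  rw [← trace_rankOne_mul, trace_mul_predual]
  exact trace_mul_nonneg hρ (posTrace_lt_top ρ.2) (Φ.map_nonneg
    ((ContinuousLinearMap.nonneg_iff_isPositive _).2 (InnerProductSpace.isPositive_rankOne_self v)))

/-- The kernel of a positive fixed point is an enclosure. -/
lemma isEnclosure_ker (Φ : QuantumChannel H) {y : H →L[ℂ] H} (hy : 0 ≤ y) (hΦ : Φ y = y) :
    Φ.IsEnclosure ⟨LinearMap.ker (y : H →ₗ[ℂ] H), y.isClosed_ker⟩ := by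
  intro ρ hρ hsupp
  have hρa : IsSelfAdjoint (ρ : H →L[ℂ] H) := .of_nonneg hρ.1
  have hya : IsSelfAdjoint y := .of_nonneg hy
  have h1 : y * (ρ : H →L[ℂ] H) = 0 := by
    ext u
    exact hsupp (apply_mem_supp hρa u)
  -- The trace of `y Φ_*(ρ)` equals that of `Φ(y) ρ = y ρ = 0`, and for positive factors zero trace
  -- forces a zero product.
  have h2 : y * (Φ.predual ρ : H →L[ℂ] H) = 0 := by
    refine mul_eq_zero_of_trace (Φ.predual_nonneg hρ.1) (posTrace_lt_top (Φ.predual ρ).2) hy ?_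
    rw [trace_mul_predual, hΦ, h1]
    simp [trace]
  have h3 : (Φ.predual ρ : H →L[ℂ] H) * y = 0 := by
    have := congrArg star h2
    rwa [star_mul, star_zero, hya.star_eq,
      (IsSelfAdjoint.of_nonneg (Φ.predual_nonneg hρ.1)).star_eq] at this
  intro w hw
  change y w = 0
  refine ext_inner_left ℂ fun u => ?_
  rw [inner_zero_right, ← ContinuousLinearMap.adjoint_inner_left, hya.adjoint_eq]
  exact mem_supp.1 hw _ (congrArg (fun f : H →L[ℂ] H => f u) h3)

/-- The projection onto an enclosure is subharmonic. -/
lemma IsEnclosure.proj_le {Φ : QuantumChannel H} {V : ClosedSubmodule ℂ H} (hV : Φ.IsEnclosure V) :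
    proj V ≤ Φ (proj V) := by
  set p := proj V with hp
  have hpp : p * p = p := proj_mul_self V
  have hps : star p = p := star_proj V
  have hq0 : 0 ≤ 1 - p := by
    have : 1 - p = star (1 - p) * (1 - p) := by
      rw [star_sub, hps, star_one, mul_sub, sub_mul, sub_mul, hpp]; simp
    rw [this]
    exact star_mul_self_nonneg _
  have hy0 : 0 ≤ 1 - Φ p := by
    have := Φ.map_nonneg hq0
    rwa [map_sub, map_one] at this
  -- The enclosure property is tested on the pure state of `v`: its image is supported in `V`, so it
  -- pairs to zero with `1 - p`.
  have hunit (v : H) (hv : v ∈ V) (hn : ‖v‖ = 1) : (1 - Φ p) v = 0 := by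
    refine apply_eq_zero_of_re_inner hy0 ?_
    have hρ0 : 0 ≤ (ketbra v : H →L[ℂ] H) :=
      (ContinuousLinearMap.nonneg_iff_isPositive _).2 (InnerProductSpace.isPositive_rankOne_self v)
    have htr : trace (ketbra v : H →L[ℂ] H) = 1 := by
      rw [← one_mul (ketbra v : H →L[ℂ] H), trace_mul_ketbra]
      simp [inner_self_eq_norm_sq_to_K, hn]
    have hs : supp (ketbra v : H →L[ℂ] H) ≤ V := by
      intro w hw
      -- The component of `w` orthogonal to `v` is in the kernel, hence orthogonal to `w`, hence
      -- zero.
      have h1 := mem_supp.1 hw (w - ⟪v, w⟫_ℂ • v) (by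
        simp [ketbra, inner_sub_right, inner_smul_right, inner_self_eq_norm_sq_to_K, hn])
      have h2 := mem_supp.1 hw
      have h3 : w - ⟪v, w⟫_ℂ • v = 0 := by
        rw [← inner_self_eq_zero (𝕜 := ℂ), inner_sub_right, h1, inner_smul_right,
          inner_sub_left, inner_smul_left, inner_self_eq_norm_sq_to_K, hn]
        simp
      rw [sub_eq_zero.1 h3]
      exact V.smul_mem _ hv
    have hσ := hV (ketbra v) ⟨hρ0, htr⟩ hs
    have hσa : IsSelfAdjoint (Φ.predual (ketbra v) : H →L[ℂ] H) :=
      .of_nonneg (Φ.predual_nonneg hρ0)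
    have h1 : p * (Φ.predual (ketbra v) : H →L[ℂ] H) = Φ.predual (ketbra v) := by
      ext u
      exact proj_apply_eq_self.2 (hσ (apply_mem_supp hσa u))
    rw [← trace_mul_ketbra, ← map_one Φ, ← map_sub, ← trace_mul_predual, sub_mul, h1]
    simp [trace]
  have hyp : (1 - Φ p) * p = 0 := by
    ext u
    have hu : p u ∈ V := V.toSubmodule.starProjection_apply_mem u
    change (1 - Φ p) (p u) = 0
    by_cases h0 : p u = 0
    · rw [h0, _root_.map_zero]
    · have := hunit (((‖p u‖ : ℂ)⁻¹) • p u) (V.smul_mem _ hu) (by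
        simp [norm_smul, h0])
      rw [_root_.map_smul, smul_eq_zero] at this
      exact this.resolve_left (by simpa using h0)
  have hpy : p * (1 - Φ p) = 0 := by
    have := congrArg star hyp
    rwa [star_mul, star_zero, hps, (IsSelfAdjoint.of_nonneg hy0).star_eq] at this
  -- Since `Φ p * p = p = p * Φ p`, the operator `Φ p` is block diagonal with `V`-corner `p`; the
  -- difference is its other corner.
  have h : Φ p - p = star (1 - p) * Φ p * (1 - p) := by
    have e1 : Φ p * p = p := by rw [sub_mul, one_mul, sub_eq_zero] at hyp; exact hyp.symm
    have e2 : p * Φ p = p := by rw [mul_sub, mul_one, sub_eq_zero] at hpy; exact hpy.symm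
    rw [star_sub, star_one, hps, sub_mul, one_mul, e2, mul_sub, mul_one, sub_mul, e1, hpp, sub_self,
      sub_zero]
  rw [← sub_nonneg, h]
  have hp0 : 0 ≤ p := by
    rw [← hpp]; nth_rewrite 1 [← hps]; exact star_mul_self_nonneg _
  exact star_left_conjugate_nonneg (Φ.map_nonneg hp0) _

end QuantumChannel

/-! ### Norm approximation of fixed points by binary expansion -/

namespace QuantumSemigroup

variable {T : Type*} [AddMonoid T] [TopologicalSpace T]
variable {H : Type*} [NormedAddCommGroup H] [InnerProductSpace ℂ H] [CompleteSpace H]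

lemma SubharmonicFixed.proj_mem {P : QuantumSemigroup T H} (hP : P.SubharmonicFixed)
    {V : ClosedSubmodule ℂ H} (hV : P.IsEnclosure V) : proj V ∈ P.fixedPoints :=
  hP _ (isStarProjection_proj V).isSelfAdjoint fun t => (hV t).proj_le

/-- The linear span of the projections onto enclosures. -/
noncomputable def enclosureSpan (P : QuantumSemigroup T H) : Submodule ℂ (H →L[ℂ] H) :=
  Submodule.span ℂ {p : H →L[ℂ] H | ∃ V : ClosedSubmodule ℂ H, P.IsEnclosure V ∧ p = proj V}

lemma one_mem_enclosureSpan (P : QuantumSemigroup T H) : 1 ∈ P.enclosureSpan :=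
  Submodule.subset_span ⟨⊤, fun _ _ _ _ => le_top, Submodule.starProjection_top'.symm⟩

/-- The first binary digit of a harmonic operator `0 ≤ x ≤ 1`. -/
lemma SubharmonicFixed.exists_digit {P : QuantumSemigroup T H} (hP : P.SubharmonicFixed)
    {x : H →L[ℂ] H} (hx : x ∈ P.fixedPoints) (h0 : 0 ≤ x) (h1 : x ≤ 1) :
    ∃ p ∈ P.enclosureSpan, p ∈ P.fixedPoints ∧ 0 ≤ (2 : ℂ) • x - p ∧ (2 : ℂ) • x - p ≤ 1 := by
  have hF1 : (1 : H →L[ℂ] H) ∈ P.fixedSubmodule := fun t => (P.channel t).map_one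
  set z : H →L[ℂ] H := (2 : ℂ) • x - 1 with hz
  have hzF : z ∈ P.fixedPoints :=
    P.fixedSubmodule.sub_mem (P.fixedSubmodule.smul_mem _ hx) hF1
  have hza : IsSelfAdjoint z := by
    have := IsSelfAdjoint.of_nonneg h0
    rw [isSelfAdjoint_iff, hz, star_sub, star_smul, this.star_eq]
    simp
  set a := z⁺
  set b := z⁻
  have ha : 0 ≤ a := CFC.posPart_nonneg z
  have hb : 0 ≤ b := CFC.negPart_nonneg z
  have hab : a * b = 0 := CFC.posPart_mul_negPart z
  have hsub : a - b = z := CFC.posPart_sub_negPart z hza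
  have haF : a ∈ P.fixedPoints := hP.posPart_mem hzF
  -- `V` plays the role of the spectral subspace `x ≤ 1/2`; as a kernel of a positive fixed operator
  -- it is an enclosure.
  set V : ClosedSubmodule ℂ H := ⟨LinearMap.ker (a : H →ₗ[ℂ] H), a.isClosed_ker⟩ with hV
  have hVe : P.IsEnclosure V := fun t => (P.channel t).isEnclosure_ker ha (haF t)
  set q := proj V
  have hq2 : q * q = q := proj_mul_self V
  have hqs : star q = q := star_proj V
  have haq : a * q = 0 := by
    ext u
    exact V.toSubmodule.starProjection_apply_mem u
  have hqb : q * b = b := by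
    ext u
    exact proj_apply_eq_self.2 (congrArg (fun f : H →L[ℂ] H => f u) hab)
  have hqa : q * a = 0 := by
    have := congrArg star haq
    rwa [star_mul, star_zero, hqs, (IsSelfAdjoint.of_nonneg ha).star_eq] at this
  have hbq : b * q = b := by
    have := congrArg star hqb
    rwa [star_mul, hqs, (IsSelfAdjoint.of_nonneg hb).star_eq] at this
  have hqzq : q * z * q = -b := by
    rw [← hsub, mul_sub, hqa, hqb, zero_sub, neg_mul, hbq]
  have hqxq : (2 : ℂ) • (star q * x * q) = q - b := by
    have hx2 : (2 : ℂ) • x = z + 1 := by rw [hz]; abel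
    rw [hqs, ← smul_mul_assoc, ← mul_smul_comm, hx2, mul_add, add_mul, hqzq, mul_one, hq2]
    abel
  have hpzp : (1 - q) * z * (1 - q) = a := by
    have e : (1 - q) * z = a := by
      rw [← hsub, sub_mul, one_mul, mul_sub, hqa, hqb]
      abel
    rw [e, mul_sub, mul_one, haq, sub_zero]
  have hpxp : (2 : ℂ) • (star (1 - q) * (1 - x) * (1 - q)) = (1 - q) - a := by
    have hx2 : (2 : ℂ) • (1 - x) = 1 - z := by rw [hz, smul_sub, two_smul]; abel
    have hp2 : (1 - q) * (1 - q) = 1 - q := by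
      rw [mul_sub, mul_one, sub_mul, one_mul, hq2, sub_self, sub_zero]
    rw [star_sub, star_one, hqs, ← smul_mul_assoc, ← mul_smul_comm, hx2, mul_sub (1 - q) 1 z,
      mul_one, sub_mul (1 - q), hp2, hpzp]
  have h2 {w : H →L[ℂ] H} (hw : 0 ≤ w) : 0 ≤ (2 : ℂ) • w := by
    rw [two_smul]; exact add_nonneg hw hw
  refine ⟨1 - q, P.enclosureSpan.sub_mem P.one_mem_enclosureSpan
    (Submodule.subset_span ⟨V, hVe, rfl⟩), P.fixedSubmodule.sub_mem hF1 (hP.proj_mem hVe), ?_, ?_⟩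
  -- The remainder is `2x` on the range of `q` and `2x - 1 = a` on its complement; both blocks are
  -- positive. The upper bound below is the mirror image, with `1 - x` and `b`.
  · have e : (2 : ℂ) • x - (1 - q) = a + (2 : ℂ) • (star q * x * q) := by
      rw [hqxq]
      have : (2 : ℂ) • x = a - b + 1 := by rw [hsub, hz]; abel
      rw [this]; abel
    rw [e]
    exact add_nonneg ha (h2 (star_left_conjugate_nonneg h0 q))
  · rw [← sub_nonneg]
    have e : 1 - ((2 : ℂ) • x - (1 - q)) = b + (2 : ℂ) • (star (1 - q) * (1 - x) * (1 - q)) := by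
      rw [hpxp]
      have : (2 : ℂ) • x = a - b + 1 := by rw [hsub, hz]; abel
      rw [this]; abel
    rw [e]
    exact add_nonneg hb (h2 (star_left_conjugate_nonneg (sub_nonneg.2 h1) _))

/-- With first digit `p`, `x = (p + x') / 2` where `x' = 2x - p` satisfies the same hypotheses, so
each digit halves the error. -/
lemma SubharmonicFixed.exists_norm_sub_le {P : QuantumSemigroup T H} (hP : P.SubharmonicFixed)
    (n : ℕ) : ∀ {x : H →L[ℂ] H}, x ∈ P.fixedPoints → 0 ≤ x → x ≤ 1 →
    ∃ s ∈ P.enclosureSpan, ‖x - s‖ ≤ (1 / 2) ^ n := by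
  induction n with
  | zero =>
    intro x _ h0 h1
    exact ⟨0, zero_mem _, by simpa using (CStarAlgebra.norm_le_one_iff_of_nonneg x h0).2 h1⟩
  | succ n ih =>
    intro x hx h0 h1
    obtain ⟨p, hp, hpF, hp0, hp1⟩ := hP.exists_digit hx h0 h1
    obtain ⟨s, hs, hn⟩ := ih (P.fixedSubmodule.sub_mem (P.fixedSubmodule.smul_mem _ hx) hpF) hp0 hp1
    refine ⟨(2⁻¹ : ℂ) • (p + s), P.enclosureSpan.smul_mem _ (P.enclosureSpan.add_mem hp hs), ?_⟩
    have e : x - (2⁻¹ : ℂ) • (p + s) = (2⁻¹ : ℂ) • ((2 : ℂ) • x - p - s) := by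
      module
    rw [e, norm_smul, pow_succ']
    gcongr
    simp

lemma SubharmonicFixed.nonneg_mem_closure {P : QuantumSemigroup T H} (hP : P.SubharmonicFixed)
    {x : H →L[ℂ] H} (hx : x ∈ P.fixedPoints) (h0 : 0 ≤ x) :
    x ∈ P.enclosureSpan.topologicalClosure := by
  rcases eq_or_ne x 0 with rfl | hne
  · exact zero_mem _
  have hpos : 0 < ‖x‖ := norm_pos_iff.2 hne
  have h0' : 0 ≤ ((‖x‖⁻¹ : ℝ) : ℂ) • x := by
    rw [Complex.coe_smul]; exact smul_nonneg (by positivity) h0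
  have h1' : ((‖x‖⁻¹ : ℝ) : ℂ) • x ≤ 1 := by
    rw [← CStarAlgebra.norm_le_one_iff_of_nonneg _ h0', norm_smul]
    simp [hpos.ne']
  have h : ((‖x‖⁻¹ : ℝ) : ℂ) • x ∈ P.enclosureSpan.topologicalClosure := by
    refine Metric.mem_closure_iff.2 fun ε hε => ?_
    obtain ⟨n, hn⟩ := exists_pow_lt_of_lt_one hε (show (1 / 2 : ℝ) < 1 by norm_num)
    obtain ⟨s, hs, hle⟩ := hP.exists_norm_sub_le n (P.fixedSubmodule.smul_mem _ hx) h0' h1'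
    exact ⟨s, hs, by rw [dist_eq_norm]; exact hle.trans_lt hn⟩
  have := P.enclosureSpan.topologicalClosure.smul_mem (‖x‖ : ℂ) h
  rwa [smul_smul, ← Complex.ofReal_mul, mul_inv_cancel₀ hpos.ne', Complex.ofReal_one,
    one_smul] at this

lemma SubharmonicFixed.isSelfAdjoint_mem_closure {P : QuantumSemigroup T H}
    (hP : P.SubharmonicFixed) {x : H →L[ℂ] H} (hx : x ∈ P.fixedPoints) (ha : IsSelfAdjoint x) :
    x ∈ P.enclosureSpan.topologicalClosure := by
  have h1 := hP.posPart_mem hx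
  have h2 : x⁻ ∈ P.fixedPoints := by
    have : x⁻ = x⁺ - x := by
      nth_rewrite 3 [← CFC.posPart_sub_negPart x ha]
      rw [sub_sub_cancel]
    rw [this]
    exact P.fixedSubmodule.sub_mem h1 hx
  rw [← CFC.posPart_sub_negPart x ha]
  exact sub_mem (hP.nonneg_mem_closure h1 (CFC.posPart_nonneg x))
    (hP.nonneg_mem_closure h2 (CFC.negPart_nonneg x))

/-- The harmonic operators are the closed span of the projections onto enclosures. -/
theorem SubharmonicFixed.fixedPoints_eq_closure {P : QuantumSemigroup T H}
    (hP : P.SubharmonicFixed) : P.fixedPoints = closure (P.enclosureSpan : Set (H →L[ℂ] H)) := by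
  refine Set.Subset.antisymm (fun x hx => ?_) (closure_minimal ?_ P.isClosed_fixedPoints)
  · have hstar := P.star_mem_fixedPoints hx
    have h1 := hP.isSelfAdjoint_mem_closure (x := x + star x)
      (P.fixedSubmodule.add_mem hx hstar) (IsSelfAdjoint.add_star_self x)
    have h2 := hP.isSelfAdjoint_mem_closure (x := Complex.I • (x - star x))
      (P.fixedSubmodule.smul_mem _ (P.fixedSubmodule.sub_mem hx hstar)) (by
        rw [isSelfAdjoint_iff, star_smul, star_sub, star_star, Complex.star_def, Complex.conj_I]
        module)
    have e : x = (2⁻¹ : ℂ) • ((x + star x) - Complex.I • (Complex.I • (x - star x))) := by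
      rw [smul_smul, Complex.I_mul_I]
      module
    rw [e]
    exact Submodule.smul_mem P.enclosureSpan.topologicalClosure _
      (sub_mem h1 (Submodule.smul_mem P.enclosureSpan.topologicalClosure _ h2))
  · have h : P.enclosureSpan ≤ P.fixedSubmodule := by
      rw [enclosureSpan, Submodule.span_le]
      rintro _ ⟨V, hV, rfl⟩
      exact hP.proj_mem hV
    exact h

end QuantumSemigroup

/-! ### Bounded potentials of increments and recurrence -/

/-- Telescoping in continuous time: the integral over `[0, R]` is that of `h` over `[R, R + s]`
minus that over `[0, s]`, each at most `M s` in absolute value. Nonnegativity of the integrand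
allows `R → ∞`. -/
lemma lintegral_Ici_shift_sub_le {h : ℝ → ℝ} (hc : Continuous h) {s M : ℝ} (hs : 0 ≤ s)
    (hM : ∀ t, |h t| ≤ M) (hmono : ∀ t, 0 ≤ h (t + s) - h t) :
    ∫⁻ t in Set.Ici 0, ENNReal.ofReal (h (t + s) - h t) ≤ ENNReal.ofReal (2 * M * s) := by
  have hcs : Continuous fun t => h (t + s) := hc.comp (by fun_prop)
  have hi (a b : ℝ) : IntervalIntegrable h volume a b := hc.intervalIntegrable a b
  have hbound (R : ℝ) : ∫ t in (0)..R, (h (t + s) - h t) ≤ 2 * M * s := by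
    rw [intervalIntegral.integral_sub (hcs.intervalIntegrable _ _) (hi _ _),
      intervalIntegral.integral_comp_add_right, zero_add,
      ← intervalIntegral.integral_add_adjacent_intervals (hi s R) (hi R (R + s)),
      ← intervalIntegral.integral_add_adjacent_intervals (hi 0 s) (hi s R)]
    have h1 : ‖∫ t in (0)..s, h t‖ ≤ M * |s - 0| :=
      intervalIntegral.norm_integral_le_of_norm_le_const fun t _ => hM t
    have h2 : ‖∫ t in R..(R + s), h t‖ ≤ M * |R + s - R| :=
      intervalIntegral.norm_integral_le_of_norm_le_const fun t _ => hM t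
    rw [sub_zero, abs_of_nonneg hs, Real.norm_eq_abs] at h1
    rw [add_sub_cancel_left, abs_of_nonneg hs, Real.norm_eq_abs] at h2
    linarith [(abs_le.1 h1).1, (abs_le.1 h2).2]
  have hint : IntegrableOn (fun t => h (t + s) - h t) (Set.Ioi 0) := by
    refine integrableOn_Ioi_of_intervalIntegral_norm_bounded (l := Filter.atTop) (b := id)
      (2 * M * s) 0 (fun R => ((hcs.sub hc).integrableOn_Icc).mono_set Set.Ioc_subset_Icc_self)
      Filter.tendsto_id (.of_forall fun R => ?_)
    simp only [Real.norm_of_nonneg (hmono _)]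
    exact hbound R
  rw [setLIntegral_congr Ioi_ae_eq_Ici.symm,
    ← ofReal_integral_eq_lintegral_ofReal hint (.of_forall fun t => hmono t)]
  exact ENNReal.ofReal_le_ofReal (le_of_tendsto
    (intervalIntegral_tendsto_integral_Ioi 0 hint Filter.tendsto_id) (.of_forall hbound))

lemma lintegral_lebesgueHalfLine (f : ℝ → ℝ≥0∞) :
    ∫⁻ t, f (t : ℝ≥0) ∂lebesgueHalfLine = ∫⁻ t in Set.Ici 0, f t := by
  have he : MeasurableEmbedding ((↑) : ℝ≥0 → ℝ) := MeasurableEmbedding.subtype_coe measurableSet_Ici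
  have hr : Set.range ((↑) : ℝ≥0 → ℝ) = Set.Ici 0 := Subtype.range_coe
  rw [← hr, ← he.map_comap, he.lintegral_map]
  rfl

namespace QuantumSemigroup

variable {T : Type*} [AddMonoid T] [TopologicalSpace T]
variable {H : Type*} [NormedAddCommGroup H] [InnerProductSpace ℂ H] [CompleteSpace H]

lemma formPotential_eq [MeasurableSpace T] (P : QuantumSemigroup T H) (m : Measure T)
    (x : H →L[ℂ] H) (v : H) :
    P.formPotential m x v = ∫⁻ t, ENNReal.ofReal (⟪v, P.channel t x v⟫_ℂ).re ∂m := by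
  simp only [formPotential, QuantumChannel.trace_mul_predual, trace_mul_ketbra]

/-- For a recurrent semigroup, a positive operator of bounded potential vanishes if its quadratic
form vanishes wherever its potential does. -/
lemma IsRecurrent.eq_zero [MeasurableSpace T] {P : QuantumSemigroup T H} {m : Measure T}
    (hR : P.IsRecurrent m) {x : H →L[ℂ] H} (hx : 0 ≤ x) (hb : P.IsBoundedPotential m x)
    (hk : ∀ v, P.formPotential m x v = 0 → (⟪v, x v⟫_ℂ).re = 0) : x = 0 := by
  have h1 : P.transientSpace m = ⊥ := (ClosedSubmodule.orthogonal_eq_top_iff _).1 hR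
  have h2 : P.suppPotential m x = ⊥ := by
    rw [eq_bot_iff, ← h1]
    exact le_sSup ⟨x, hx, hb, rfl⟩
  have h3 : (Submodule.span ℂ {v | P.formPotential m x v = 0})ᗮ = ⊥ :=
    congrArg ClosedSubmodule.toSubmodule h2
  rw [← Submodule.topologicalClosure_eq_top_iff, ← Submodule.dense_iff_topologicalClosure_eq_top]
    at h3
  -- Trivial support means that the null vectors of the potential span a dense subspace, and `x`
  -- kills each of them.
  exact ContinuousLinearMap.ext_on h3 fun v hv => apply_eq_zero_of_re_inner hx (hk v hv)

/-- Positive unital maps preserve `z ≤ ‖z‖ 1`, so the bound is uniform in time. -/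
lemma re_inner_channel_le (P : QuantumSemigroup T H) {z : H →L[ℂ] H} (hz : IsSelfAdjoint z)
    (t : T) (v : H) : (⟪v, P.channel t z v⟫_ℂ).re ≤ ‖z‖ * ‖v‖ ^ 2 := by
  have h1 : z ≤ (‖z‖ : ℂ) • (1 : H →L[ℂ] H) := by
    have := IsSelfAdjoint.le_algebraMap_norm_self hz
    rwa [Algebra.algebraMap_eq_smul_one, ← Complex.coe_smul] at this
  have h2 := (P.channel t).mono h1
  rw [QuantumChannel.map_smul, QuantumChannel.map_one] at h2
  have h3 := re_inner_nonneg (sub_nonneg.2 h2) v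
  have h4 : (⟪v, ((‖z‖ : ℂ) • (1 : H →L[ℂ] H)) v⟫_ℂ).re = ‖z‖ * ‖v‖ ^ 2 := by
    rw [smul_apply, inner_smul_right, one_apply_eq_self,
      Complex.re_ofReal_mul]
    exact congrArg (‖z‖ * ·) (inner_self_eq_norm_sq (𝕜 := ℂ) v)
  rw [sub_apply, inner_sub_right, Complex.sub_re, h4] at h3
  linarith

lemma re_inner_channel_mono (P : QuantumSemigroup T H) {z : H →L[ℂ] H}
    (hs : ∀ t, z ≤ P.channel t z) (s t : T) (v : H) :
    (⟪v, P.channel t z v⟫_ℂ).re ≤ (⟪v, P.channel (t + s) z v⟫_ℂ).re := by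
  have h2 := (P.channel t).mono (hs s)
  rw [← P.channel_add] at h2
  have h3 := re_inner_nonneg (sub_nonneg.2 h2) v
  rw [sub_apply, inner_sub_right, Complex.sub_re] at h3
  linarith

lemma abs_re_inner_channel_le (P : QuantumSemigroup T H) {z : H →L[ℂ] H} (hz : IsSelfAdjoint z)
    (t : T) (v : H) : |(⟪v, P.channel t z v⟫_ℂ).re| ≤ ‖z‖ * ‖v‖ ^ 2 := by
  refine abs_le.2 ⟨?_, P.re_inner_channel_le hz t v⟩
  have h1 := P.re_inner_channel_le hz.neg t v
  have h2 : P.channel t (-z) = -P.channel t z := (P.channel t).toLinearMap.map_neg z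
  rw [h2, neg_apply, inner_neg_right, Complex.neg_re, norm_neg] at h1
  linarith

lemma re_inner_channel_increment (P : QuantumSemigroup T H) (z : H →L[ℂ] H) (s t : T) (v : H) :
    (⟪v, P.channel t (P.channel s z - z) v⟫_ℂ).re
      = (⟪v, P.channel (t + s) z v⟫_ℂ).re - (⟪v, P.channel t z v⟫_ℂ).re := by
  rw [QuantumChannel.map_sub, ← P.channel_add, sub_apply, inner_sub_right,
    Complex.sub_re]

/-- The `n`-th partial sum of the potential of `P_1 z - z` telescopes to the form of `P_n z - z`,
whence the constant `2‖z‖`. Where the potential vanishes, so does its term at time `0`. -/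
theorem subharmonicFixed_nat {P : QuantumSemigroup ℕ H} (hR : P.IsRecurrent Measure.count) :
    P.SubharmonicFixed := by
  intro z hz hs
  have hx : P.channel 1 z - z = 0 := by
    refine hR.eq_zero (sub_nonneg.2 (hs 1)) ⟨2 * ‖z‖₊, fun v => ?_⟩ fun v hv => ?_
    · rw [formPotential_eq, lintegral_count]
      refine ENNReal.tsum_le_of_sum_range_le fun n => ?_
      simp only [re_inner_channel_increment]
      rw [← ENNReal.ofReal_sum_of_nonneg fun t _ => sub_nonneg.2 (P.re_inner_channel_mono hs 1 t v),
        Finset.sum_range_sub fun t => (⟪v, P.channel t z v⟫_ℂ).re,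
        ← ENNReal.ofReal_coe_nnreal, ← ENNReal.ofReal_mul (by positivity)]
      refine ENNReal.ofReal_le_ofReal ?_
      have h1 := (abs_le.1 (P.abs_re_inner_channel_le hz n v)).2
      have h2 := (abs_le.1 (P.abs_re_inner_channel_le hz 0 v)).1
      push_cast
      linarith
    · rw [formPotential_eq, lintegral_count, ENNReal.tsum_eq_zero] at hv
      have h0 := hv 0
      rw [P.channel_zero, ENNReal.ofReal_eq_zero] at h0
      exact le_antisymm h0 (re_inner_nonneg (sub_nonneg.2 (hs 1)) v)
  intro n
  induction n with
  | zero => exact P.channel_zero z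
  | succ n ih => rw [P.channel_add, sub_eq_zero.1 hx, ih]

lemma continuous_re_inner_channel (P : QuantumSemigroup T H) (x : H →L[ℂ] H) (v : H) :
    Continuous fun t => (⟪v, P.channel t x v⟫_ℂ).re := by
  have h1 : Continuous[weakStarTopology H, inferInstance]
      (fun x : H →L[ℂ] H => trace (x * (ketbra v : H →L[ℂ] H))) :=
    continuous_iInf_dom (i := ketbra v) continuous_induced_dom
  have h2 : Continuous fun t => trace (P.channel t x * (ketbra v : H →L[ℂ] H)) :=
    @Continuous.comp _ _ _ _ (weakStarTopology H) _ _ _ h1 (P.weakStar_continuous x)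
  simp only [trace_mul_ketbra] at h2
  exact Complex.continuous_re.comp h2

/-- Each `s` is treated separately: the potential of `P_s z - z` is at most `2‖z‖ s ‖v‖²` by
continuous telescoping. -/
theorem subharmonicFixed_nnreal {P : QuantumSemigroup ℝ≥0 H} (hR : P.IsRecurrent lebesgueHalfLine) :
    P.SubharmonicFixed := by
  intro z hz hs s
  rw [← sub_eq_zero]
  have hpot (v : H) : P.formPotential lebesgueHalfLine (P.channel s z - z) v
      = ∫⁻ t in Set.Ici (0 : ℝ),
        ENNReal.ofReal (⟪v, P.channel t.toNNReal (P.channel s z - z) v⟫_ℂ).re := by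
    rw [formPotential_eq, ← lintegral_lebesgueHalfLine fun t =>
      ENNReal.ofReal (⟪v, P.channel t.toNNReal (P.channel s z - z) v⟫_ℂ).re]
    simp only [Real.toNNReal_coe]
  -- Composing with `Real.toNNReal` extends the orbit to negative times by its value at `0`, keeping
  -- it continuous and, for `z`, monotone on all of `ℝ`.
  have hcont (x : H →L[ℂ] H) (v : H) :
      Continuous fun t : ℝ => (⟪v, P.channel t.toNNReal x v⟫_ℂ).re :=
    (P.continuous_re_inner_channel x v).comp continuous_real_toNNReal
  refine hR.eq_zero (sub_nonneg.2 (hs s)) ⟨2 * ‖z‖₊ * s, fun v => ?_⟩ fun v hv => ?_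
  · have hmono : Monotone fun t => (⟪v, P.channel t z v⟫_ℂ).re := fun a b hab => by
      obtain ⟨c, rfl⟩ := exists_add_of_le hab
      exact P.re_inner_channel_mono hs c a v
    have h := lintegral_Ici_shift_sub_le (hcont z v) s.coe_nonneg
      (fun t => P.abs_re_inner_channel_le hz t.toNNReal v)
      (fun t => sub_nonneg.2 (hmono (Real.toNNReal_le_toNNReal (by simp))))
    rw [hpot]
    refine (setLIntegral_congr_fun measurableSet_Ici fun t ht => ?_).trans_le (h.trans_eq ?_)
    · simp only [re_inner_channel_increment]
      rw [Real.toNNReal_add ht s.coe_nonneg, Real.toNNReal_coe]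
    · rw [← ENNReal.ofReal_coe_nnreal, ← ENNReal.ofReal_mul (by positivity)]
      push_cast
      congr 1
      ring
  · rw [hpot, lintegral_eq_zero_iff (hcont _ v).measurable.ennreal_ofReal] at hv
    -- A zero integral gives vanishing only almost everywhere; continuity on `[0, 1]` recovers the
    -- value at time `0`.
    have h1 := Measure.eqOn_Icc_of_ae_eq volume zero_ne_one
      (ae_restrict_of_ae_restrict_of_subset Set.Icc_subset_Ici_self hv)
      (ENNReal.continuous_ofReal.comp (hcont _ v)).continuousOn continuousOn_const
      (Set.left_mem_Icc.2 zero_le_one)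
    have h0 := ENNReal.ofReal_eq_zero.1 h1
    rw [Real.toNNReal_zero, P.channel_zero] at h0
    exact le_antisymm h0 (re_inner_nonneg (sub_nonneg.2 (hs s)) v)

end QuantumSemigroup
theorem mainTheorem6 {H : Type*} [NormedAddCommGroup H] [InnerProductSpace ℂ H] [CompleteSpace H]
    [TopologicalSpace.SeparableSpace H] :
    -- discrete time
    (∀ P : QuantumSemigroup ℕ H, P.IsRecurrent MeasureTheory.Measure.count →
      (∀ V : ClosedSubmodule ℂ H, P.IsEnclosure V → QChannel.proj V ∈ P.fixedPoints) ∧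
      P.fixedPoints = closure (Submodule.span ℂ
        {p : H →L[ℂ] H | ∃ V : ClosedSubmodule ℂ H, P.IsEnclosure V ∧ p = QChannel.proj V} :
          Set (H →L[ℂ] H))) ∧
    -- continuous time
    (∀ P : QuantumSemigroup NNReal H, P.IsRecurrent lebesgueHalfLine →
      (∀ V : ClosedSubmodule ℂ H, P.IsEnclosure V → QChannel.proj V ∈ P.fixedPoints) ∧
      P.fixedPoints = closure (Submodule.span ℂ
        {p : H →L[ℂ] H | ∃ V : ClosedSubmodule ℂ H, P.IsEnclosure V ∧ p = QChannel.proj V} :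
          Set (H →L[ℂ] H))) := by
  exact ⟨fun P hR => ⟨fun V hV => (QuantumSemigroup.subharmonicFixed_nat hR).proj_mem hV,
      (QuantumSemigroup.subharmonicFixed_nat hR).fixedPoints_eq_closure⟩,
    fun P hR => ⟨fun V hV => (QuantumSemigroup.subharmonicFixed_nnreal hR).proj_mem hV,
      (QuantumSemigroup.subharmonicFixed_nnreal hR).fixedPoints_eq_closure⟩⟩
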